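/- **Setting.** Let $\Phi\in\mathbb{R}^{m\times n}$ have columns (atoms) $\phi_1,\dots,\phi_n$ with $\|\phi_j\|_2=1$ for all $j$, let $X=(x_1,\dots,x_K)\in\mathbb{R}^{n\times K}$ with joint support $\mathcal S=\bigcup_k \mathrm{supp}(x_k)$, and let $Y=\Phi X+E$, where the columns $e_1,\dots,e_K$ of $E$ are independent random vectors with $e_k\sim\mathcal N(0,\sigma_k^2 I_{m\times m})$, $\sigma_k\ge 0$, $\sigma=(\sigma_1,\dots,\sigma_K)\neq 0$. Simultaneous orthogonal matching pursuit (SOMP) starts from $\mathcal S_0=\emptyset$; at iteration $t=0,1,\dots$ it forms the residual $R^{(t)}=(I-\Phi_{\mathcal S_t}\Phi_{\mathcal S_t}^+)Y$, picks an index $j_t\in\arg\max_{j\in[n]}\|(R^{(t)})^{\mathrm T}\phi_j\|_1$ (ties broken in any way) and sets $\mathcal S_{t+1}=\mathcal S_t\cup\{j_t\}$. Here $\Phi_T$ is the matrix of the columns of $\Phi$ indexed by $T$ and $\Phi_T^+$ its Moore-Penrose pseudoinverse, so that $\Phi_T\Phi_T^+$ is the orthogonal projector onto the span of these columns. Let $\mathcal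 P^{(t)}$ be the set of the projectors $\Phi_T\Phi_T^+$ with $T\subseteq\mathcal S$, $|T|=t$, and for $P\in\mathcal P^{(t)}$ put $\beta_{j,k}^{(P)}=|\langle\phi_j,(I-P)\Phi x_k\rangle|$, $$\gamma_c^{(P)}=\max_{j\in\mathcal S}\sum_{k=1}^K\beta_{j,k}^{(P)},\qquad \gamma_i^{(P)}=\max_{j\notin\mathcal S}\sum_{k=1}^K\beta_{j,k}^{(P)}$$ (a maximum over the empty set being $0$). **Theorem.** Let $s\ge 0$ be an integer and let $\Gamma>1$, $\psi$, $\tau_X$ be real numbers such that, for all $t\in\{0,\dots,s\}$ and all $P\in\mathcal P^{(t)}$, $$\gamma_c^{(P)}\ge\Gamma\,\gamma_i^{(P)}\qquad\text{and}\qquad\gamma_c^{(P)}\ge\psi\,\tau_X .$$ Put $\Delta E:=\left(1-\frac1\Gamma\right)\psi\,\tau_X-\sqrt{\frac2\pi}\,\|\sigma\|_1$. If $\Delta E>0$, then the probability that SOMP applied to $Y$ and $\Phi$ picks at least one incorrect atom (an index outside $\mathcal S$) during iterations $0,\dots,s$ is at most $$n\,C_s\exp\left(-\frac{(\Delta E)^2}{8\|\sigma\|_2^2}\right),\qquad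 C_s:=\sum_{t=0}^s\binom{|\mathcal S|}{t},$$ and, if $s\ge1$, $\;C_s\le\left(\frac{e(|\mathcal S|+s-1)}{s}\right)^s+1$. -/

import Mathlib

open MeasureTheory ProbabilityTheory

noncomputable section

namespace SOMP

variable {m n K : ℕ}

/-- The `k`-th column of a matrix with `m` rows, as a vector of Euclidean space `ℝ^m`. -/
def vec {N : ℕ} (A : Matrix (Fin m) (Fin N) ℝ) (k : Fin N) : EuclideanSpace ℝ (Fin m) :=
  WithLp.toLp 2 (fun i => A i k)

/-- The joint support `supp X = ⋃ₖ supp xₖ` of the columns of `X`. -/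
def jointSupport (X : Matrix (Fin n) (Fin K) ℝ) : Finset (Fin n) :=
  Finset.univ.biUnion fun k => Finset.univ.filter fun j => X j k ≠ 0

/-- The orthogonal projector `Φ_T Φ_T⁺` onto the range of `Φ_T`, the span of the atoms
indexed by `T`. -/
def projector (Φ : Matrix (Fin m) (Fin n) ℝ) (T : Finset (Fin n)) :
    EuclideanSpace ℝ (Fin m) →L[ℝ] EuclideanSpace ℝ (Fin m) :=
  (Submodule.span ℝ (vec Φ '' (T : Set (Fin n)))).starProjection

/-- The set `𝒫^(t)` of the projectors `Φ_T Φ_T⁺` with `T ⊆ S` and `|T| = t`. -/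
def projectors (Φ : Matrix (Fin m) (Fin n) ℝ) (S : Finset (Fin n)) (t : ℕ) :
    Set (EuclideanSpace ℝ (Fin m) →L[ℝ] EuclideanSpace ℝ (Fin m)) :=
  {P | ∃ T : Finset (Fin n), T ⊆ S ∧ T.card = t ∧ P = projector Φ T}

/-! ### The algorithm -/

/-- The SOMP metric `‖Rᵀ φ_j‖₁ = ∑ₖ |⟨φ_j, r_k⟩|` of the `j`-th atom for the residual `R`. -/
def metric (Φ : Matrix (Fin m) (Fin n) ℝ) (R : Matrix (Fin m) (Fin K) ℝ) (j : Fin n) : ℝ :=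
  ∑ k, |inner ℝ (vec Φ j) (vec R k)|

/-- The residual `R = Y - Φ_T Φ_T⁺ Y` for the estimated support `T`. -/
def residual (Φ : Matrix (Fin m) (Fin n) ℝ) (Y : Matrix (Fin m) (Fin K) ℝ)
    (T : Finset (Fin n)) : Matrix (Fin m) (Fin K) ℝ :=
  Matrix.of fun i k => (vec Y k - projector Φ T (vec Y k)) i

/-- The estimated supports: `S₀ = ∅`, `S_{t+1} = S_t ∪ {j_t}`. -/
def estSupport (j : ℕ → Fin n) : ℕ → Finset (Fin n)
  | 0 => ∅
  | t + 1 => insert (j t) (estSupport j t)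

/-- `j 0, …, j s` are atom indices that SOMP with input `Y`, `Φ` may pick during iterations
`0, …, s`: at each iteration `j t` maximizes the metric for the current residual (ties may be
broken in any way). -/
def IsRun (Φ : Matrix (Fin m) (Fin n) ℝ) (Y : Matrix (Fin m) (Fin K) ℝ) (s : ℕ)
    (j : ℕ → Fin n) : Prop :=
  ∀ t ≤ s, ∀ i : Fin n,
    metric Φ (residual Φ Y (estSupport j t)) i ≤
      metric Φ (residual Φ Y (estSupport j t)) (j t)

/-- SOMP with input `Y`, `Φ` picks, for some way of breaking ties, at least one atom outside `S`
during iterations `0, …, s`. -/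
def Fails (Φ : Matrix (Fin m) (Fin n) ℝ) (Y : Matrix (Fin m) (Fin K) ℝ) (S : Finset (Fin n))
    (s : ℕ) : Prop :=
  ∃ j : ℕ → Fin n, IsRun Φ Y s j ∧ ∃ t ≤ s, j t ∉ S

/-! ### Noiseless reliability -/

/-- `β_{j,k} = |⟨φ_j, (I - P) Φ x_k⟩|`. -/
def beta (Φ : Matrix (Fin m) (Fin n) ℝ) (X : Matrix (Fin n) (Fin K) ℝ)
    (P : EuclideanSpace ℝ (Fin m) →L[ℝ] EuclideanSpace ℝ (Fin m)) (j : Fin n) (k : Fin K) : ℝ :=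
  |inner ℝ (vec Φ j) (vec (Φ * X) k - P (vec (Φ * X) k))|

/-- `max_{j ∈ A} ∑ₖ β_{j,k}`, the highest noiseless metric among the atoms indexed by `A`
(it is `0` if `A` is empty). -/
def bestMetric (Φ : Matrix (Fin m) (Fin n) ℝ) (X : Matrix (Fin n) (Fin K) ℝ)
    (P : EuclideanSpace ℝ (Fin m) →L[ℝ] EuclideanSpace ℝ (Fin m)) (A : Finset (Fin n)) : ℝ :=
  ⨆ j : {j : Fin n // j ∈ A}, ∑ k, beta Φ X P j.1 k

/-- `γ_c`: the highest noiseless metric among the correct atoms. -/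
def gammaC (Φ : Matrix (Fin m) (Fin n) ℝ) (X : Matrix (Fin n) (Fin K) ℝ)
    (P : EuclideanSpace ℝ (Fin m) →L[ℝ] EuclideanSpace ℝ (Fin m)) : ℝ :=
  bestMetric Φ X P (jointSupport X)

/-- `γ_i`: the highest noiseless metric among the incorrect atoms. -/
def gammaI (Φ : Matrix (Fin m) (Fin n) ℝ) (X : Matrix (Fin n) (Fin K) ℝ)
    (P : EuclideanSpace ℝ (Fin m) →L[ℝ] EuclideanSpace ℝ (Fin m)) : ℝ :=
  bestMetric Φ X P (jointSupport X)ᶜ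

/-! ### Noise and constants -/

/-- The columns of the random matrix `E` are (mutually) independent and the `k`-th one is
distributed as `𝒩(0, σₖ² I)`. -/
structure IsGaussianNoise {Ω : Type*} [MeasurableSpace Ω] (μ : Measure Ω)
    (E : Ω → Matrix (Fin m) (Fin K) ℝ) (σ : Fin K → ℝ) : Prop where
  indep : iIndepFun (fun k ω => vec (E ω) k) μ
  law : ∀ k, HasLaw (fun ω => vec (E ω) k)
    (multivariateGaussian 0 (σ k ^ 2 • (1 : Matrix (Fin m) (Fin m) ℝ))) μ

/-- `ΔE = (1 - 1/Γ) ψ τ_X - √(2/π) ‖σ‖₁`. -/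
def deltaE (Γ ψ τ : ℝ) (σ : Fin K → ℝ) : ℝ :=
  (1 - 1 / Γ) * ψ * τ - √(2 / Real.pi) * ∑ k, |σ k|

/-- `C_s = ∑_{t=0}^s binom(N, t)`. -/
def binomSum (N s : ℕ) : ℕ :=
  ∑ t ∈ Finset.range (s + 1), N.choose t

end SOMP

end

/-!
Before its first error SOMP has selected a set `T` of at most `s` correct atoms, one of
`C_s` possible sets (`Fails.exists_candidate`, `card_candidates_le`). By a union bound it suffices
to treat a fixed `T`. The metric of an atom is then `∑ₖ |aₖ + gₖ|`, where `aₖ` is the noiseless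
inner product and the `gₖ` are independent centred Gaussian variables of standard deviation at most
`σₖ` (`metric_residual`, `IsGaussianNoise.hasLaw_inner`).

By Jensen's inequality noise does not decrease the expected metric, and by the triangle inequality
it increases it by at most `√(2/π) ‖σ‖₁`. Hence the best noiseless correct atom exceeds every
incorrect atom by at least `ΔE` in expectation. An incorrect atom can only be picked if one of the
two metrics is off its expectation by `ΔE / 2` in the unfavourable direction
(`setOf_fails_subset`); since only one direction matters for each atom, at most `n` one-sided
events arise for each `T`.

Each such event has probability at most `exp (-(ΔE / 2)² / (2 ‖σ‖₂²))`, because the metric is a sum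
of independent terms, the `k`-th one sub-Gaussian with variance proxy `σₖ²`. This needs the sharp
concentration inequality for an `L`-Lipschitz function of a standard Gaussian variable
(`hasSubgaussianMGF_gaussianReal_of_lipschitzWith`). It is proved for a simple random walk, where
one averages over one step at a time and uses `cosh x ≤ exp (x² / 2)`
(`integral_exp_walkMeasure_le`), and then transferred to the Gaussian law by the central limit
theorem. The bound on `C_s` follows from `∑_{1 ≤ t ≤ s} binom(N, t) ≤ binom(N + s - 1, s)` for
`N ≥ 1` (`binomSum_le_choose`).
-/

noncomputable section

open Filter Topology
open scoped ENNReal NNReal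

namespace SOMP

/-! ### Concentration of Lipschitz functions of a Gaussian variable -/

/-- The law of a symmetric random sign multiplied by `h`. -/
def signMeasure (h : ℝ) : Measure ℝ :=
  (2⁻¹ : ℝ≥0∞) • Measure.dirac h + (2⁻¹ : ℝ≥0∞) • Measure.dirac (-h)

instance (h : ℝ) : IsProbabilityMeasure (signMeasure h) :=
  ⟨by simp [signMeasure, ENNReal.inv_two_add_inv_two]⟩

lemma integral_signMeasure {F : Type*} [NormedAddCommGroup F] [NormedSpace ℝ F] [CompleteSpace F]
    (h : ℝ) (f : ℝ → F) :
    ∫ x, f x ∂signMeasure h = (2⁻¹ : ℝ) • f h + (2⁻¹ : ℝ) • f (-h) := by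
  have hi (x : ℝ) : Integrable f ((2⁻¹ : ℝ≥0∞) • Measure.dirac x) :=
    (integrable_dirac (by simp)).smul_measure (by simp)
  rw [signMeasure, integral_add_measure (hi _) (hi _)]
  simp

/-- The law at time `N` of the symmetric random walk on `ℝ` that starts at `0` and has steps
`± h`. -/
def walkMeasure (h : ℝ) : ℕ → Measure ℝ
  | 0 => Measure.dirac 0
  | N + 1 => walkMeasure h N ∗ signMeasure h

instance (h : ℝ) (N : ℕ) : IsProbabilityMeasure (walkMeasure h N) := by
  induction N with
  | zero => exact inferInstanceAs (IsProbabilityMeasure (Measure.dirac (0 : ℝ)))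
  | succ N ih => exact inferInstanceAs (IsProbabilityMeasure (walkMeasure h N ∗ signMeasure h))

lemma charFun_walkMeasure (h : ℝ) (N : ℕ) (t : ℝ) :
    charFun (walkMeasure h N) t = charFun (signMeasure 1) (h * t) ^ N := by
  have hs : charFun (signMeasure 1) (h * t) = charFun (signMeasure h) t := by
    simp [charFun_apply_real, integral_signMeasure, mul_comm]
  induction N with
  | zero => simp [walkMeasure]
  | succ N ih => rw [walkMeasure, charFun_conv, ih, hs, pow_succ]

/-- The central limit theorem for the walk with step `1 / √N` at time `N`. -/
lemma tendsto_integral_walkMeasure (f : BoundedContinuousFunction ℝ ℝ) :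
    Tendsto (fun N : ℕ => ∫ x, f x ∂walkMeasure (√N)⁻¹ N) atTop
      (𝓝 (∫ x, f x ∂gaussianReal 0 1)) := by
  let ν (N : ℕ) : ProbabilityMeasure ℝ := ⟨walkMeasure (√N)⁻¹ N, inferInstance⟩
  let γ : ProbabilityMeasure ℝ := ⟨gaussianReal 0 1, inferInstance⟩
  have h : Tendsto ν atTop (𝓝 γ) := by
    refine ProbabilityMeasure.tendsto_iff_tendsto_charFun.2 fun t => ?_
    have := tendsto_charFun_inv_sqrt_mul_pow (P := signMeasure 1) (X := id) aemeasurable_id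
      (by simp [integral_signMeasure]) (by simp [integral_signMeasure]; norm_num) t
    simpa [ν, γ, charFun_walkMeasure, charFun_gaussianReal, neg_div] using this
  exact ProbabilityMeasure.tendsto_iff_forall_integral_tendsto.1 h f

lemma integral_walkMeasure_succ (h : ℝ) (N : ℕ) {f : ℝ → ℝ} (hf : Continuous f) {B : ℝ}
    (hB : ∀ x, |f x| ≤ B) :
    ∫ x, f x ∂walkMeasure h (N + 1) = ∫ x, 2⁻¹ * (f (x + h) + f (x - h)) ∂walkMeasure h N := by
  rw [walkMeasure, integral_conv]
  · refine integral_congr_ae (.of_forall fun x => ?_)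
    simp only [integral_signMeasure, smul_eq_mul]
    ring_nf
  · exact .of_bound hf.aestronglyMeasurable B (.of_forall hB)

/-- An `L`-Lipschitz function moves by at most `2 L h` in one step of the walk, so that averaging
over one step costs a factor `cosh (L h) ≤ exp ((L h) ^ 2 / 2)`; the averaged function is
`L`-Lipschitz again. -/
lemma integral_exp_walkMeasure_le (h : ℝ) (N : ℕ) {L : ℝ≥0} {f : ℝ → ℝ} (hf : LipschitzWith L f)
    {B : ℝ} (hB : ∀ x, |f x| ≤ B) :
    ∫ x, Real.exp (f x) ∂walkMeasure h N ≤
      Real.exp (∫ x, f x ∂walkMeasure h N + N * ((L * h) ^ 2 / 2)) := by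
  induction N generalizing f with
  | zero => simp [walkMeasure]
  | succ N ih =>
    set g : ℝ → ℝ := fun x => 2⁻¹ * (f (x + h) + f (x - h)) with hg
    have hgL : LipschitzWith L g := by
      refine LipschitzWith.of_dist_le_mul fun x y => ?_
      have h1 := hf.dist_le_mul (x + h) (y + h)
      have h2 := hf.dist_le_mul (x - h) (y - h)
      simp only [Real.dist_eq, add_sub_add_right_eq_sub, sub_sub_sub_cancel_right, hg] at h1 h2 ⊢
      rw [abs_le] at *
      constructor <;> linarith
    have hgB (x : ℝ) : |g x| ≤ B := by
      have h1 := hB (x + h)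
      have h2 := hB (x - h)
      simp only [hg]
      rw [abs_le] at *
      constructor <;> linarith
    have hexpB {u : ℝ → ℝ} (hu : ∀ x, |u x| ≤ B) (x : ℝ) : |Real.exp (u x)| ≤ Real.exp B := by
      rw [Real.abs_exp]
      exact Real.exp_le_exp.2 ((le_abs_self _).trans (hu x))
    have hstep (x : ℝ) : 2⁻¹ * (Real.exp (f (x + h)) + Real.exp (f (x - h))) ≤
        Real.exp ((L * h) ^ 2 / 2) * Real.exp (g x) := by
      have hd : |(f (x + h) - f (x - h)) / 2| ≤ |L * h| := by
        have h1 := hf.dist_le_mul (x + h) (x - h)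
        rw [Real.dist_eq, Real.dist_eq, show x + h - (x - h) = 2 * h by ring, abs_mul] at h1
        rw [abs_div, abs_mul, NNReal.abs_eq]
        norm_num at h1 ⊢
        linarith
      calc 2⁻¹ * (Real.exp (f (x + h)) + Real.exp (f (x - h)))
          = Real.cosh ((f (x + h) - f (x - h)) / 2) * Real.exp (g x) := by
            rw [Real.cosh_eq, div_mul_eq_mul_div, add_mul, ← Real.exp_add, ← Real.exp_add, hg]
            ring_nf
        _ ≤ _ := by
            gcongr
            exact (Real.cosh_le_cosh.2 hd).trans (Real.cosh_le_exp_half_sq _)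
    have hce {u : ℝ → ℝ} (hu : LipschitzWith L u) : Continuous fun x => Real.exp (u x) :=
      Real.continuous_exp.comp hu.continuous
    calc ∫ x, Real.exp (f x) ∂walkMeasure h (N + 1)
        = ∫ x, 2⁻¹ * (Real.exp (f (x + h)) + Real.exp (f (x - h))) ∂walkMeasure h N :=
          integral_walkMeasure_succ h N (hce hf) (hexpB hB)
      _ ≤ ∫ x, Real.exp ((L * h) ^ 2 / 2) * Real.exp (g x) ∂walkMeasure h N :=
          integral_mono_of_nonneg (.of_forall fun x => by positivity)
            ((Integrable.of_bound (hce hgL).aestronglyMeasurable _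
              (.of_forall (hexpB hgB))).const_mul _) (.of_forall hstep)
      _ = Real.exp ((L * h) ^ 2 / 2) * ∫ x, Real.exp (g x) ∂walkMeasure h N :=
          integral_const_mul _ _
      _ ≤ Real.exp ((L * h) ^ 2 / 2) *
            Real.exp (∫ x, g x ∂walkMeasure h N + N * ((L * h) ^ 2 / 2)) := by
          gcongr
          exact ih hgL hgB
      _ = _ := by
          have hfg : ∫ x, f x ∂walkMeasure h (N + 1) = ∫ x, g x ∂walkMeasure h N :=
            integral_walkMeasure_succ h N hf.continuous hB
          rw [← Real.exp_add, hfg]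
          push_cast
          ring_nf

lemma integral_exp_gaussianReal_le_of_bounded {L : ℝ≥0} {f : ℝ → ℝ} (hf : LipschitzWith L f)
    {B : ℝ} (hB : ∀ x, |f x| ≤ B) :
    ∫ x, Real.exp (f x) ∂gaussianReal 0 1 ≤
      Real.exp (∫ x, f x ∂gaussianReal 0 1 + L ^ 2 / 2) := by
  have h1 := tendsto_integral_walkMeasure
    (.ofNormedAddCommGroup f hf.continuous B hB)
  have h2 := tendsto_integral_walkMeasure
    (.ofNormedAddCommGroup (fun x => Real.exp (f x)) (Real.continuous_exp.comp hf.continuous)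
      (Real.exp B) fun x => by
        rw [Real.norm_eq_abs, Real.abs_exp]
        exact Real.exp_le_exp.2 ((le_abs_self _).trans (hB x)))
  refine le_of_tendsto_of_tendsto h2
    ((Real.continuous_exp.tendsto _).comp (h1.add_const ((L : ℝ) ^ 2 / 2))) ?_
  filter_upwards [eventually_gt_atTop 0] with N hN
  have h3 := integral_exp_walkMeasure_le (√N)⁻¹ N hf hB
  have h4 : (N : ℝ) * ((L * (√N)⁻¹) ^ 2 / 2) = L ^ 2 / 2 := by
    rw [mul_pow, inv_pow, Real.sq_sqrt (Nat.cast_nonneg N)]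
    field_simp
  rw [h4] at h3
  exact h3

lemma abs_le_of_lipschitzWith {L : ℝ≥0} {f : ℝ → ℝ} (hf : LipschitzWith L f) (x : ℝ) :
    |f x| ≤ |f 0| + L * |x| := by
  have h := hf.dist_le_mul x 0
  rw [Real.dist_eq, Real.dist_eq, sub_zero] at h
  have := abs_add_le (f 0) (f x - f 0)
  rw [add_sub_cancel] at this
  linarith

lemma integrable_abs_gaussianReal : Integrable (fun x : ℝ => |x|) (gaussianReal 0 1) :=
  ((memLp_id_gaussianReal 1).integrable le_rfl).abs

lemma integrable_gaussianReal_of_lipschitzWith {L : ℝ≥0} {f : ℝ → ℝ} (hf : LipschitzWith L f) :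
    Integrable f (gaussianReal 0 1) :=
  ((integrable_const _).add (integrable_abs_gaussianReal.const_mul _)).mono'
    hf.continuous.aestronglyMeasurable (.of_forall (abs_le_of_lipschitzWith hf))

lemma integrable_exp_abs_gaussianReal_of_lipschitzWith {L : ℝ≥0} {f : ℝ → ℝ}
    (hf : LipschitzWith L f) : Integrable (fun x => Real.exp |f x|) (gaussianReal 0 1) := by
  have h := (integrable_exp_mul_abs (X := fun x : ℝ => x)
    (integrable_exp_mul_gaussianReal (μ := 0) (v := 1) L)
    (integrable_exp_mul_gaussianReal (-L : ℝ))).const_mul (Real.exp |f 0|)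
  refine h.mono' (Real.continuous_exp.comp hf.continuous.abs).aestronglyMeasurable
    (.of_forall fun x => ?_)
  rw [Real.norm_eq_abs, Real.abs_exp, ← Real.exp_add]
  exact Real.exp_le_exp.2 (abs_le_of_lipschitzWith hf x)

/-- The bounded case applied to the truncations of `f` at height `N`. -/
lemma integral_exp_gaussianReal_le {L : ℝ≥0} {f : ℝ → ℝ} (hf : LipschitzWith L f) :
    ∫ x, Real.exp (f x) ∂gaussianReal 0 1 ≤
      Real.exp (∫ x, f x ∂gaussianReal 0 1 + L ^ 2 / 2) := by
  let F (N : ℕ) (x : ℝ) : ℝ := max (-N) (min N (f x))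
  have hF (N : ℕ) : LipschitzWith L (F N) := (hf.const_min _).const_max _
  have hFB (N : ℕ) (x : ℝ) : |F N x| ≤ N := by
    have : (0 : ℝ) ≤ N := N.cast_nonneg
    exact abs_le.2 ⟨le_max_left _ _, max_le (by linarith) (min_le_left _ _)⟩
  have hFf (N : ℕ) (x : ℝ) : |F N x| ≤ |f x| := by
    have : (0 : ℝ) ≤ N := N.cast_nonneg
    simp only [F]
    rcases max_cases (-(N : ℝ)) (min N (f x)) with h | h <;>
    rcases min_cases (N : ℝ) (f x) with h' | h' <;>
    rcases abs_cases (f x) with h'' | h'' <;>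
    · rw [abs_le]
      constructor <;> linarith
  have hlim (x : ℝ) : Tendsto (fun N => F N x) atTop (𝓝 (f x)) := by
    refine tendsto_const_nhds.congr' ?_
    filter_upwards [eventually_ge_atTop ⌈|f x|⌉₊] with N hN
    have := abs_le.1 (Nat.ceil_le.1 hN)
    simp only [F]
    rw [min_eq_right this.2, max_eq_right this.1]
  have h1 : Tendsto (fun N => ∫ x, F N x ∂gaussianReal 0 1) atTop
      (𝓝 (∫ x, f x ∂gaussianReal 0 1)) :=
    tendsto_integral_of_dominated_convergence (fun x => |f x|)
      (fun N => (hF N).continuous.aestronglyMeasurable)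
      (integrable_gaussianReal_of_lipschitzWith hf).abs
      (fun N => .of_forall (hFf N)) (.of_forall hlim)
  have h2 : Tendsto (fun N => ∫ x, Real.exp (F N x) ∂gaussianReal 0 1) atTop
      (𝓝 (∫ x, Real.exp (f x) ∂gaussianReal 0 1)) :=
    tendsto_integral_of_dominated_convergence (fun x => Real.exp |f x|)
      (fun N => (Real.continuous_exp.comp (hF N).continuous).aestronglyMeasurable)
      (integrable_exp_abs_gaussianReal_of_lipschitzWith hf)
      (fun N => .of_forall fun x => by
        rw [Real.norm_eq_abs, Real.abs_exp]
        exact Real.exp_le_exp.2 ((le_abs_self _).trans (hFf N x)))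
      (.of_forall fun x => (Real.continuous_exp.tendsto _).comp (hlim x))
  exact le_of_tendsto_of_tendsto' h2
    ((Real.continuous_exp.tendsto _).comp (h1.add_const ((L : ℝ) ^ 2 / 2)))
    fun N => integral_exp_gaussianReal_le_of_bounded (hF N) (hFB N)

/-- Gaussian concentration with the sharp variance proxy `L ^ 2`: the exponential bound applied to
the `|t| L`-Lipschitz functions `t (f - 𝔼 f)`. -/
lemma hasSubgaussianMGF_gaussianReal_of_lipschitzWith {L : ℝ≥0} {f : ℝ → ℝ}
    (hf : LipschitzWith L f) :
    HasSubgaussianMGF (fun x => f x - ∫ y, f y ∂gaussianReal 0 1) (L ^ 2) (gaussianReal 0 1) := by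
  have hL (t : ℝ) : LipschitzWith (‖t‖₊ * L)
      fun x => t * (f x - ∫ y, f y ∂gaussianReal 0 1) := by
    refine LipschitzWith.of_dist_le_mul fun x y => ?_
    have h := hf.dist_le_mul x y
    rw [Real.dist_eq] at h ⊢
    rw [← mul_sub, sub_sub_sub_cancel_right, abs_mul, NNReal.coe_mul, coe_nnnorm,
      Real.norm_eq_abs, mul_assoc]
    gcongr
  refine ⟨fun t => ?_, fun t => ?_⟩
  · refine (integrable_exp_abs_gaussianReal_of_lipschitzWith (hL t)).mono'
      (Real.continuous_exp.comp (hL t).continuous).aestronglyMeasurable (.of_forall fun x => ?_)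
    rw [Real.norm_eq_abs, Real.abs_exp]
    exact Real.exp_le_exp.2 (le_abs_self _)
  · refine (integral_exp_gaussianReal_le (hL t)).trans_eq ?_
    rw [integral_const_mul, integral_sub (integrable_gaussianReal_of_lipschitzWith hf)
      (integrable_const _)]
    simp [mul_pow]
    ring

/-! ### The folded Gaussian variable -/

lemma integral_abs_gaussianReal : ∫ x, |x| ∂gaussianReal 0 1 = √(2 / Real.pi) := by
  have h := integral_rpow_mul_exp_neg_mul_rpow (p := 2) (q := 1) (b := 1 / 2) (by norm_num)
    (by norm_num) (by norm_num)
  rw [integral_gaussianReal_eq_integral_smul one_ne_zero]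
  have h1 (x : ℝ) : gaussianPDFReal 0 1 x • |x| =
      (√(2 * Real.pi))⁻¹ * (|x| ^ (1 : ℝ) * Real.exp (-(1 / 2) * |x| ^ (2 : ℝ))) := by
    simp [gaussianPDFReal]
    ring_nf
  simp_rw [h1]
  rw [integral_const_mul,
    integral_comp_abs (f := fun x : ℝ => x ^ (1 : ℝ) * Real.exp (-(1 / 2) * x ^ (2 : ℝ))), h]
  norm_num
  rw [div_eq_mul_inv (√2)]
  have : √2 ≠ 0 := by positivity
  have h2 : (√2) ^ 2 = 2 := Real.sq_sqrt (by norm_num)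
  field_simp
  linarith

lemma lipschitzWith_abs_add_mul (a : ℝ) {c : ℝ} {L : ℝ≥0} (hc : |c| ≤ L) :
    LipschitzWith L fun x : ℝ => |a + c * x| := by
  refine LipschitzWith.of_dist_le_mul fun x y => ?_
  rw [Real.dist_eq, Real.dist_eq]
  refine (abs_abs_sub_abs_le _ _).trans ?_
  rw [add_sub_add_left_eq_sub, ← mul_sub, abs_mul]
  gcongr

lemma abs_le_integral_abs_add_mul (a c : ℝ) :
    |a| ≤ ∫ x, |a + c * x| ∂gaussianReal 0 1 := by
  have hi : Integrable (fun x : ℝ => c * x) (gaussianReal 0 1) :=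
    ((memLp_id_gaussianReal 1).integrable le_rfl).const_mul c
  have h : ∫ x, (a + c * x) ∂gaussianReal 0 1 = a := by
    rw [integral_add (integrable_const _) hi, integral_const_mul]
    simp
  calc |a| = |∫ x, (a + c * x) ∂gaussianReal 0 1| := by rw [h]
    _ ≤ _ := abs_integral_le_integral_abs

lemma integral_abs_add_mul_le (a c : ℝ) :
    ∫ x, |a + c * x| ∂gaussianReal 0 1 ≤ |a| + √(2 / Real.pi) * |c| := by
  have hi := integrable_abs_gaussianReal.const_mul |c|
  calc ∫ x, |a + c * x| ∂gaussianReal 0 1 ≤ ∫ x, (|a| + |c| * |x|) ∂gaussianReal 0 1 := by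
        refine integral_mono_of_nonneg (.of_forall fun x => abs_nonneg _)
          ((integrable_const _).add hi) (.of_forall fun x => ?_)
        simpa [abs_mul] using abs_add_le a (c * x)
    _ = _ := by
        rw [integral_add (integrable_const _) hi, integral_const_mul, integral_abs_gaussianReal]
        simp [mul_comm]

section Law

variable {Ω : Type*} [MeasurableSpace Ω] {μ : Measure Ω} {Z : Ω → ℝ} {c : ℝ}

lemma map_const_mul_gaussianReal_one (c : ℝ) :
    (gaussianReal 0 1).map (c * ·) = gaussianReal 0 (c ^ 2).toNNReal := by
  rw [gaussianReal_map_const_mul]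
  congr 1
  · simp
  · ext
    simp [sq_nonneg]

lemma integral_abs_add_of_hasLaw (hZ : HasLaw Z (gaussianReal 0 (c ^ 2).toNNReal) μ) (a : ℝ) :
    ∫ ω, |a + Z ω| ∂μ = ∫ x, |a + c * x| ∂gaussianReal 0 1 := by
  have h : Continuous fun x : ℝ => |a + x| := by fun_prop
  have h1 := hZ.integral_comp (f := fun x => |a + x|) h.aestronglyMeasurable
  rw [← map_const_mul_gaussianReal_one, integral_map (by fun_prop) h.aestronglyMeasurable] at h1
  exact h1

lemma hasSubgaussianMGF_abs_add_of_hasLaw (hZ : HasLaw Z (gaussianReal 0 (c ^ 2).toNNReal) μ)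
    (a : ℝ) {L : ℝ≥0} (hc : |c| ≤ L) :
    HasSubgaussianMGF (fun ω => |a + Z ω| - ∫ ω, |a + Z ω| ∂μ) (L ^ 2) μ := by
  have h := hasSubgaussianMGF_gaussianReal_of_lipschitzWith (lipschitzWith_abs_add_mul a hc)
  rw [← integral_abs_add_of_hasLaw hZ a] at h
  rw [← map_const_mul_gaussianReal_one] at hZ
  refine h.congr_identDistrib (IdentDistrib.symm ?_)
  have hid : IdentDistrib Z (fun x => c * x) μ (gaussianReal 0 1) :=
    ⟨hZ.aemeasurable, by fun_prop, hZ.map_eq⟩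
  exact hid.comp (u := fun x => |a + x| - ∫ ω, |a + Z ω| ∂μ) (by fun_prop)

end Law

/-! ### The metric of an atom under Gaussian noise -/

variable {m n K : ℕ}

lemma vec_add {N : ℕ} (A B : Matrix (Fin m) (Fin N) ℝ) (k : Fin N) :
    vec (A + B) k = vec A k + vec B k := rfl

/-- The component `(I - P) φ_j` of the atom `φ_j` orthogonal to the atoms indexed by `T`. -/
def atomResidual (Φ : Matrix (Fin m) (Fin n) ℝ) (T : Finset (Fin n)) (j : Fin n) :
    EuclideanSpace ℝ (Fin m) :=
  vec Φ j - projector Φ T (vec Φ j)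

lemma norm_atomResidual_le (Φ : Matrix (Fin m) (Fin n) ℝ) (T : Finset (Fin n)) (j : Fin n) :
    ‖atomResidual Φ T j‖ ≤ ‖vec Φ j‖ := by
  have h := Submodule.norm_starProjection_apply_le
    (Submodule.span ℝ (vec Φ '' (T : Set (Fin n))))ᗮ (vec Φ j)
  rw [Submodule.starProjection_orthogonal] at h
  exact h

lemma inner_sub_projector (Φ : Matrix (Fin m) (Fin n) ℝ) (T : Finset (Fin n)) (j : Fin n)
    (v : EuclideanSpace ℝ (Fin m)) :
    inner ℝ (vec Φ j) (v - projector Φ T v) = inner ℝ (atomResidual Φ T j) v := by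
  rw [atomResidual, inner_sub_left, inner_sub_right, projector,
    Submodule.inner_starProjection_left_eq_right]

lemma metric_residual (Φ : Matrix (Fin m) (Fin n) ℝ) (A B : Matrix (Fin m) (Fin K) ℝ)
    (T : Finset (Fin n)) (j : Fin n) :
    metric Φ (residual Φ (A + B) T) j =
      ∑ k, |inner ℝ (vec Φ j) (vec A k - projector Φ T (vec A k)) +
        inner ℝ (atomResidual Φ T j) (vec B k)| := by
  refine Finset.sum_congr rfl fun k _ => ?_
  have h : vec (residual Φ (A + B) T) k =
    vec (A + B) k - projector Φ T (vec (A + B) k) := rfl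
  rw [h, inner_sub_projector, inner_sub_projector, vec_add, inner_add_right]

section Noise

variable {Ω : Type*} [MeasurableSpace Ω] {μ : Measure Ω} {σ : Fin K → ℝ}
  {E : Ω → Matrix (Fin m) (Fin K) ℝ}

lemma IsGaussianNoise.hasLaw_inner (hE : IsGaussianNoise μ E σ) (u : EuclideanSpace ℝ (Fin m))
    (k : Fin K) :
    HasLaw (fun ω => inner ℝ u (vec (E ω) k))
      (gaussianReal 0 ((σ k * ‖u‖) ^ 2).toNNReal) μ := by
  set S : Matrix (Fin m) (Fin m) ℝ := σ k ^ 2 • 1 with hSdef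
  have hS : S.PosSemidef := Matrix.PosSemidef.one.smul (sq_nonneg _)
  have hv : Var[innerSL ℝ u; multivariateGaussian 0 S] = (σ k * ‖u‖) ^ 2 := by
    have h := covarianceBilin_self (μ := multivariateGaussian 0 S) IsGaussian.memLp_two_id u
    rw [covarianceBilin_multivariateGaussian hS] at h
    refine h.symm.trans ?_
    rw [hSdef, Matrix.smul_mulVec, Matrix.one_mulVec, dotProduct_smul, mul_pow,
      EuclideanSpace.real_norm_sq_eq]
    simp [dotProduct, pow_two]
  have hm : ∫ x, innerSL ℝ u x ∂multivariateGaussian 0 S = 0 := by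
    rw [ContinuousLinearMap.integral_comp_id_comm IsGaussian.integrable_id]
    simp
  have h : HasLaw (innerSL ℝ u) (gaussianReal 0 ((σ k * ‖u‖) ^ 2).toNNReal)
      (multivariateGaussian 0 S) :=
    ⟨by fun_prop, by rw [IsGaussian.map_eq_gaussianReal, hv, hm]⟩
  exact h.comp (hE.law k)

/-- A single column of noise contributes at most `√(2/π) σ_k` to the expected metric of an atom. -/
lemma IsGaussianNoise.integral_abs_le (hE : IsGaussianNoise μ E σ)
    {u : EuclideanSpace ℝ (Fin m)} (hu : ‖u‖ ≤ 1) (a : ℝ) (k : Fin K) :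
    ∫ ω, |a + inner ℝ u (vec (E ω) k)| ∂μ ≤ |a| + √(2 / Real.pi) * |σ k| := by
  rw [integral_abs_add_of_hasLaw (hE.hasLaw_inner u k)]
  refine (integral_abs_add_mul_le _ _).trans ?_
  rw [abs_mul, abs_norm]
  gcongr
  exact mul_le_of_le_one_right (abs_nonneg _) hu

lemma IsGaussianNoise.le_integral_abs (hE : IsGaussianNoise μ E σ)
    (u : EuclideanSpace ℝ (Fin m)) (a : ℝ) (k : Fin K) :
    |a| ≤ ∫ ω, |a + inner ℝ u (vec (E ω) k)| ∂μ := by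
  rw [integral_abs_add_of_hasLaw (hE.hasLaw_inner u k)]
  exact abs_le_integral_abs_add_mul _ _

lemma IsGaussianNoise.hasSubgaussianMGF_sum (hE : IsGaussianNoise μ E σ)
    {u : EuclideanSpace ℝ (Fin m)} (hu : ‖u‖ ≤ 1) (a : Fin K → ℝ) :
    HasSubgaussianMGF
      (fun ω => ∑ k, |a k + inner ℝ u (vec (E ω) k)| -
        ∑ k, ∫ ω, |a k + inner ℝ u (vec (E ω) k)| ∂μ)
      (∑ k, ‖σ k‖₊ ^ 2) μ := by
  have hind : iIndepFun (fun k ω => |a k + inner ℝ u (vec (E ω) k)| -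
      ∫ ω, |a k + inner ℝ u (vec (E ω) k)| ∂μ) μ :=
    hE.indep.comp (fun k v => |a k + inner ℝ u v| - ∫ ω, |a k + inner ℝ u (vec (E ω) k)| ∂μ)
      fun k => by fun_prop
  have h := HasSubgaussianMGF.sum_of_iIndepFun hind (s := Finset.univ)
    (c := fun k => ‖σ k‖₊ ^ 2) fun k _ =>
      hasSubgaussianMGF_abs_add_of_hasLaw (hE.hasLaw_inner u k) (a k) (by
        rw [abs_mul, abs_norm, coe_nnnorm, Real.norm_eq_abs]
        exact mul_le_of_le_one_right (abs_nonneg _) hu)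
  simpa only [Finset.sum_sub_distrib] using h

end Noise

/-! ### The number of candidate supports -/

/-- The sets of at most `s` correct atoms: the estimated supports that SOMP can reach before its
first error. -/
def candidates (S : Finset (Fin n)) (s : ℕ) : Finset (Finset (Fin n)) :=
  (Finset.range (s + 1)).biUnion fun t => S.powersetCard t

lemma mem_candidates {S T : Finset (Fin n)} {s : ℕ} :
    T ∈ candidates S s ↔ T ⊆ S ∧ T.card ≤ s := by
  simp only [candidates, Finset.mem_biUnion, Finset.mem_range, Finset.mem_powersetCard,
    Nat.lt_succ_iff]
  grind

lemma card_candidates_le (S : Finset (Fin n)) (s : ℕ) :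
    (candidates S s).card ≤ binomSum S.card s :=
  Finset.card_biUnion_le.trans_eq (by simp [binomSum])

/-- The bound `C_s ≤ binom(N + s - 1, s) + 1` with `N` and `s` shifted by one, which makes the
subtraction harmless; it follows from Pascal's rule by induction on `s`. -/
lemma binomSum_le_choose (N s : ℕ) :
    binomSum (N + 1) (s + 1) ≤ (N + s + 1).choose (s + 1) + 1 := by
  induction s with
  | zero => simp [binomSum, Finset.sum_range_succ]; omega
  | succ s ih =>
    have h1 : binomSum (N + 1) (s + 1 + 1) = binomSum (N + 1) (s + 1) + (N + 1).choose (s + 2) :=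
      Finset.sum_range_succ _ _
    have h2 : (N + 1).choose (s + 2) ≤ (N + s + 1).choose (s + 2) :=
      Nat.choose_le_choose _ (by omega)
    have h3 : (N + (s + 1) + 1).choose (s + 1 + 1) =
      (N + s + 1).choose (s + 1) + (N + s + 1).choose (s + 2) := Nat.choose_succ_succ _ _
    omega

lemma choose_le_exp_mul_div_pow (M : ℕ) {s : ℕ} (hs : s ≠ 0) :
    (M.choose s : ℝ) ≤ (Real.exp 1 * M / s) ^ s := by
  have hs' : (0 : ℝ) < s := by positivity
  have h1 := Real.pow_div_factorial_le_exp (x := s) hs'.le s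
  calc (M.choose s : ℝ) ≤ (M : ℝ) ^ s / s.factorial := Nat.choose_le_pow_div s M
    _ = ((s : ℝ) ^ s / s.factorial) * ((M : ℝ) / s) ^ s := by
        rw [div_pow]
        field_simp
    _ ≤ Real.exp s * ((M : ℝ) / s) ^ s := by gcongr
    _ = _ := by
        rw [← Real.exp_one_pow, ← mul_pow, mul_div_assoc]

lemma binomSum_le (N : ℕ) {s : ℕ} (hs : 1 ≤ s) :
    (binomSum N s : ℝ) ≤ (Real.exp 1 * ((N : ℝ) + s - 1) / s) ^ s + 1 := by
  obtain ⟨s, rfl⟩ := Nat.exists_eq_add_of_le' hs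
  cases N with
  | zero =>
    have h : binomSum 0 (s + 1) = 1 := by
      simp [binomSum, Finset.sum_range_succ' _ (s + 1)]
    rw [h]
    push_cast
    have : (0 : ℝ) ≤ Real.exp 1 * (0 + (s + 1) - 1) / (s + 1) := by
      rw [zero_add, add_sub_cancel_right]
      positivity
    linarith [pow_nonneg this (s + 1)]
  | succ N =>
    have h1 : (binomSum (N + 1) (s + 1) : ℝ) ≤ ((N + s + 1).choose (s + 1) : ℕ) + 1 := by
      exact_mod_cast binomSum_le_choose N s
    have h2 := choose_le_exp_mul_div_pow (N + s + 1) s.succ_ne_zero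
    have h3 : ((N + 1 : ℕ) : ℝ) + (s + 1 : ℕ) - 1 = (N + s + 1 : ℕ) := by
      push_cast
      ring
    rw [h3]
    exact h1.trans (add_le_add_left h2 1)

/-! ### From a failure to a large deviation -/

/-- Taken at the first error. An atom may be selected twice when ties are broken badly, so the
support reached at iteration `t` may have fewer than `t` elements. -/
lemma Fails.exists_candidate {Φ : Matrix (Fin m) (Fin n) ℝ} {Y : Matrix (Fin m) (Fin K) ℝ}
    {S : Finset (Fin n)} {s : ℕ} (h : Fails Φ Y S s) :
    ∃ T ∈ candidates S s, ∃ j ∉ S, ∀ i,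
      metric Φ (residual Φ Y T) i ≤ metric Φ (residual Φ Y T) j := by
  classical
  obtain ⟨j, hrun, h⟩ := h
  obtain ⟨hts, htS⟩ := Nat.find_spec h
  have hmin (t : ℕ) (ht : t < Nat.find h) : j t ∈ S := by
    by_contra hS
    exact Nat.find_min h ht ⟨by omega, hS⟩
  have hsub (t : ℕ) : t ≤ Nat.find h → estSupport j t ⊆ S ∧ (estSupport j t).card ≤ t := by
    induction t with
    | zero => simp [estSupport]
    | succ t ih =>
      intro ht
      obtain ⟨h1, h2⟩ := ih (by omega)
      exact ⟨Finset.insert_subset (hmin t ht) h1,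
        (Finset.card_insert_le _ _).trans (by omega)⟩
  obtain ⟨h1, h2⟩ := hsub _ le_rfl
  exact ⟨_, mem_candidates.2 ⟨h1, h2.trans hts⟩, _, htS, hrun _ hts⟩

lemma le_bestMetric {Φ : Matrix (Fin m) (Fin n) ℝ} {X : Matrix (Fin n) (Fin K) ℝ}
    {P : EuclideanSpace ℝ (Fin m) →L[ℝ] EuclideanSpace ℝ (Fin m)} {A : Finset (Fin n)} {j : Fin n}
    (hj : j ∈ A) : ∑ k, beta Φ X P j k ≤ bestMetric Φ X P A :=
  le_ciSup (f := fun j : {j : Fin n // j ∈ A} => ∑ k, beta Φ X P j.1 k)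
    (Set.finite_range _).bddAbove ⟨j, hj⟩

/-- Positivity excludes the value `0` that `bestMetric` takes on the empty set. -/
lemma exists_eq_bestMetric {Φ : Matrix (Fin m) (Fin n) ℝ} {X : Matrix (Fin n) (Fin K) ℝ}
    {P : EuclideanSpace ℝ (Fin m) →L[ℝ] EuclideanSpace ℝ (Fin m)} {A : Finset (Fin n)}
    (h : 0 < bestMetric Φ X P A) : ∃ j ∈ A, ∑ k, beta Φ X P j k = bestMetric Φ X P A := by
  rcases isEmpty_or_nonempty {j : Fin n // j ∈ A} with hA | hA
  · rw [bestMetric, Real.iSup_of_isEmpty] at h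
    exact absurd h (lt_irrefl _)
  · obtain ⟨j, hj⟩ := exists_eq_ciSup_of_finite
      (f := fun j : {j : Fin n // j ∈ A} => ∑ k, beta Φ X P j.1 k)
    exact ⟨j.1, j.2, hj⟩

section Deviation

variable {Ω : Type*} [MeasurableSpace Ω] (Φ : Matrix (Fin m) (Fin n) ℝ)
  (X : Matrix (Fin n) (Fin K) ℝ) (μ : Measure Ω) (E : Ω → Matrix (Fin m) (Fin K) ℝ)

/-- The expected metric of the `j`-th atom when the estimated support is `T`. It is written as a
sum of expectations over the columns. -/
def meanMetric (T : Finset (Fin n)) (j : Fin n) : ℝ :=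
  ∑ k, ∫ ω, |inner ℝ (vec Φ j) (vec (Φ * X) k - projector Φ T (vec (Φ * X) k)) +
    inner ℝ (atomResidual Φ T j) (vec (E ω) k)| ∂μ

/-- The event that the metric of the `j`-th atom for the support `T` is off its expectation by at
least `ε` in the unfavourable direction: too low if the atom is correct, too high if not. -/
def deviationEvent (ε : ℝ) (T : Finset (Fin n)) (j : Fin n) : Set Ω :=
  {ω | if j ∈ jointSupport X
    then ε ≤ meanMetric Φ X μ E T j - metric Φ (residual Φ (Φ * X + E ω) T) j
    else ε ≤ metric Φ (residual Φ (Φ * X + E ω) T) j - meanMetric Φ X μ E T j}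

variable {Φ X μ E} {σ : Fin K → ℝ}

lemma measureReal_deviationEvent_le (hΦ : ∀ j, ‖vec Φ j‖ = 1) (hE : IsGaussianNoise μ E σ)
    {ε : ℝ} (hε : 0 ≤ ε) (T : Finset (Fin n)) (j : Fin n) :
    μ.real (deviationEvent Φ X μ E ε T j) ≤ Real.exp (-ε ^ 2 / (2 * ∑ k, σ k ^ 2)) := by
  have h := hE.hasSubgaussianMGF_sum ((norm_atomResidual_le Φ T j).trans_eq (hΦ j))
    fun k => inner ℝ (vec Φ j) (vec (Φ * X) k - projector Φ T (vec (Φ * X) k))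
  simp only [← metric_residual] at h
  change HasSubgaussianMGF (fun ω => metric Φ (residual Φ (Φ * X + E ω) T) j -
    meanMetric Φ X μ E T j) _ μ at h
  have hc : ((∑ k, ‖σ k‖₊ ^ 2 : ℝ≥0) : ℝ) = ∑ k, σ k ^ 2 := by simp
  by_cases hj : j ∈ jointSupport X
  · have h' := h.neg.measure_ge_le hε
    simpa only [deviationEvent, hj, if_true, hc, Pi.neg_apply, neg_sub] using h'
  · have h' := h.measure_ge_le hε
    simpa only [deviationEvent, hj, if_false, hc] using h'

lemma meanMetric_le (hΦ : ∀ j, ‖vec Φ j‖ = 1) (hE : IsGaussianNoise μ E σ)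
    (T : Finset (Fin n)) (j : Fin n) :
    meanMetric Φ X μ E T j ≤
      ∑ k, beta Φ X (projector Φ T) j k + √(2 / Real.pi) * ∑ k, |σ k| := by
  rw [Finset.mul_sum, ← Finset.sum_add_distrib]
  exact Finset.sum_le_sum fun k _ =>
    hE.integral_abs_le ((norm_atomResidual_le Φ T j).trans_eq (hΦ j)) _ k

lemma le_meanMetric (hE : IsGaussianNoise μ E σ) (T : Finset (Fin n)) (j : Fin n) :
    ∑ k, beta Φ X (projector Φ T) j k ≤ meanMetric Φ X μ E T j :=
  Finset.sum_le_sum fun k _ => hE.le_integral_abs _ _ k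

/-- At the first error an incorrect atom beats the best noiseless correct atom, although its
expected metric is lower by at least `ΔE`; so one of these two metrics is off by `ΔE / 2`. -/
lemma setOf_fails_subset (hΦ : ∀ j, ‖vec Φ j‖ = 1) (hE : IsGaussianNoise μ E σ) {s : ℕ}
    {Γ ψ τ : ℝ} (hΓ : 1 < Γ)
    (hrel : ∀ t ≤ s, ∀ P ∈ projectors Φ (jointSupport X) t, Γ * gammaI Φ X P ≤ gammaC Φ X P)
    (habs : ∀ t ≤ s, ∀ P ∈ projectors Φ (jointSupport X) t, ψ * τ ≤ gammaC Φ X P)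
    (hΔ : 0 < deltaE Γ ψ τ σ) :
    {ω | Fails Φ (Φ * X + E ω) (jointSupport X) s} ⊆
      ⋃ T ∈ candidates (jointSupport X) s, ⋃ j ∈ (Finset.univ : Finset (Fin n)),
        deviationEvent Φ X μ E (deltaE Γ ψ τ σ / 2) T j := by
  intro ω hω
  obtain ⟨T, hT, j, hj, hmax⟩ := Fails.exists_candidate hω
  obtain ⟨hTS, hTs⟩ := mem_candidates.1 hT
  have hP : projector Φ T ∈ projectors Φ (jointSupport X) T.card := ⟨T, hTS, rfl, rfl⟩
  have hrelT := hrel _ hTs _ hP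
  have habsT := habs _ hTs _ hP
  have hθ : 0 < 1 - 1 / Γ := sub_pos.2 ((div_lt_one (by linarith)).2 hΓ)
  have hnoise : 0 ≤ √(2 / Real.pi) * ∑ k, |σ k| := by positivity
  -- Positivity of `ψ τ`, hence of `γ_c`, guarantees that there is a correct atom at all.
  have hψτ : 0 < ψ * τ := by
    rw [deltaE, mul_assoc] at hΔ
    exact pos_of_mul_pos_right (by linarith : 0 < (1 - 1 / Γ) * (ψ * τ)) hθ.le
  obtain ⟨i, hi, hiγ⟩ := exists_eq_bestMetric (hψτ.trans_le habsT)
  have hjγ : ∑ k, beta Φ X (projector Φ T) j k ≤ gammaI Φ X (projector Φ T) :=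
    le_bestMetric (Finset.mem_compl.2 hj)
  have hgap : deltaE Γ ψ τ σ ≤ meanMetric Φ X μ E T i - meanMetric Φ X μ E T j := by
    have h1 := le_meanMetric (Φ := Φ) (X := X) hE T i
    have h2 := meanMetric_le (X := X) hΦ hE T j
    have h3 : gammaI Φ X (projector Φ T) ≤ 1 / Γ * gammaC Φ X (projector Φ T) := by
      rw [one_div_mul_eq_div, le_div_iff₀ (by linarith)]
      linarith
    have h4 := mul_le_mul_of_nonneg_left habsT hθ.le
    rw [deltaE, mul_assoc]
    change _ = gammaC Φ X (projector Φ T) at hiγ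
    linarith
  have hij := hmax i
  simp only [Set.mem_iUnion, Finset.mem_univ, exists_true_left]
  rcases le_total (deltaE Γ ψ τ σ / 2)
    (metric Φ (residual Φ (Φ * X + E ω) T) j - meanMetric Φ X μ E T j) with h | h
  · refine ⟨T, hT, j, ?_⟩
    simpa only [deviationEvent, Set.mem_ofPred_eq, hj, if_false] using h
  · refine ⟨T, hT, i, ?_⟩
    simp only [deviationEvent, Set.mem_ofPred_eq, hi, if_true]
    linarith

end Deviation

end SOMP

end

theorem theorem3 {m n K : ℕ} (Φ : Matrix (Fin m) (Fin n) ℝ) (X : Matrix (Fin n) (Fin K) ℝ)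
    (hΦ : ∀ j, ‖SOMP.vec Φ j‖ = 1)
    {Ω : Type*} [MeasurableSpace Ω] (μ : Measure Ω) [IsProbabilityMeasure μ]
    (σ : Fin K → ℝ) (hσ : ∀ k, 0 ≤ σ k) (hσ0 : σ ≠ 0)
    (E : Ω → Matrix (Fin m) (Fin K) ℝ) (hE : SOMP.IsGaussianNoise μ E σ)
    (s : ℕ) (Γ ψ τ : ℝ) (hΓ : 1 < Γ)
    (hrel : ∀ t ≤ s, ∀ P ∈ SOMP.projectors Φ (SOMP.jointSupport X) t,
      Γ * SOMP.gammaI Φ X P ≤ SOMP.gammaC Φ X P)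
    (habs : ∀ t ≤ s, ∀ P ∈ SOMP.projectors Φ (SOMP.jointSupport X) t,
      ψ * τ ≤ SOMP.gammaC Φ X P)
    (hΔ : 0 < SOMP.deltaE Γ ψ τ σ) :
    μ.real {ω | SOMP.Fails Φ (Φ * X + E ω) (SOMP.jointSupport X) s} ≤
        n * SOMP.binomSum (SOMP.jointSupport X).card s *
          Real.exp (-(1 / (8 * ∑ k, σ k ^ 2)) * SOMP.deltaE Γ ψ τ σ ^ 2) ∧
      (1 ≤ s → (SOMP.binomSum (SOMP.jointSupport X).card s : ℝ) ≤
        (Real.exp 1 * (((SOMP.jointSupport X).card : ℝ) + s - 1) / s) ^ s + 1) := by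
  refine ⟨?_, SOMP.binomSum_le _⟩
  set S := SOMP.jointSupport X
  set Δ := SOMP.deltaE Γ ψ τ σ
  set p := Real.exp (-(1 / (8 * ∑ k, σ k ^ 2)) * Δ ^ 2) with hp
  have hdev (T : Finset (Fin n)) (j : Fin n) :
      μ.real (SOMP.deviationEvent Φ X μ E (Δ / 2) T j) ≤ p := by
    refine (SOMP.measureReal_deviationEvent_le hΦ hE (half_pos hΔ).le T j).trans_eq ?_
    rw [hp]
    congr 1
    simp only [div_eq_mul_inv, mul_inv]
    ring
  calc μ.real {ω | SOMP.Fails Φ (Φ * X + E ω) S s}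
      ≤ μ.real (⋃ T ∈ SOMP.candidates S s, ⋃ j ∈ (Finset.univ : Finset (Fin n)),
          SOMP.deviationEvent Φ X μ E (Δ / 2) T j) :=
        measureReal_mono (SOMP.setOf_fails_subset hΦ hE hΓ hrel habs hΔ) (measure_ne_top _ _)
    _ ≤ ∑ T ∈ SOMP.candidates S s, ∑ j : Fin n, p :=
        (measureReal_biUnion_finset_le _ _).trans <| Finset.sum_le_sum fun T _ =>
          (measureReal_biUnion_finset_le _ _).trans <| Finset.sum_le_sum fun j _ => hdev T j
    _ = n * (SOMP.candidates S s).card * p := by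
        simp only [Finset.sum_const, Finset.card_univ, Fintype.card_fin, nsmul_eq_mul]
        ring
    _ ≤ n * SOMP.binomSum S.card s * p := by
        have hp0 : 0 ≤ p := (Real.exp_pos _).le
        gcongr
        exact SOMP.card_candidates_le S s
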